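/- Let $N\in\mathbb N$, let $W_{-1},W_0\in\mathbb C^{N\times N}$, where $W_{-1}$ is diagonalizable with all eigenvalues strictly negative integers and $W_0$ is invertible. Write $I$ for the identity matrix and $\dagger$ for the conjugate transpose. (1) Let $w:\mathbb C\setminus\{0\}\to\mathrm{GL}(N,\mathbb C)$ be holomorphic with $w'(z)\,w(z)^{-1}=W_{-1}z^{-1}+W_0$ for all $z\neq 0$. Put $\mathrm d m(\zeta)=\frac{\mathrm d\zeta}{2\pi \mathrm i\zeta}$ on the unit circle $\mathbb T$ and $\hat\mu(k)=\oint_{\mathbb T}\bar\zeta^{k}w(\zeta)\,\mathrm dm(\zeta)$, $k\in\mathbb Z$, and assume that $w\,\mathrm dm$ is quasi-definite, i.e. the block Toeplitz matrices $(\hat\mu(i-j))_{0\le i,j<n}$ and $(\hat\mu(j-i))_{0\le i,j<n}$ are nonsingular for every $n\ge 1$. For $n\ge 0$ let $P^L_{1,n}$ and $P^R_{2,n}$ be the matrix polynomials $I z^n+(\text{lower-degree terms})$ with $$\oint_{\mathbb T}P^L_{1,n}(\zeta)w(\zeta)\bar\zeta^{j}\,\mathrm dm(\zeta)=0,\qquad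 \oint_{\mathbb T}\big(P^R_{2,n}(\zeta)\big)^\dagger w(\zeta)\zeta^{j}\,\mathrm dm(\zeta)=0,\qquad 0\le j\le n-1,$$ and let $\alpha^L_{1,n}=P^L_{1,n}(0)$, $\alpha^R_{2,n}=P^R_{2,n}(0)$ be the Verblunsky matrices (so $\alpha^L_{1,0}=\alpha^R_{2,0}=I$). Then for every $n\ge 1$ the matrix $I-(\alpha^R_{2,n})^\dagger\alpha^L_{1,n}$ is invertible and $$\begin{aligned} \text{(i)}\quad&\big[\alpha^L_{1,n}(\alpha^R_{2,n-1})^\dagger,W_0\big]=\alpha^L_{1,n}(W_{-1}-nI)(\alpha^R_{2,n})^\dagger-\alpha^L_{1,n-1}(W_{-1}-(n-1)I)(\alpha^R_{2,n-1})^\dagger,\\ \text{(ii)}\quad&W_0\,\alpha^L_{1,n+1}=\alpha^L_{1,n}(W_{-1}-nI),\\ \text{(iii)}\quad&(\alpha^R_{2,n-1})^\dagger W_0=(W_{-1}-nI)(\alpha^R_{2,n})^\dagger,\\ \text{(iv)}\quad&-n\big(I-(\alpha^R_{2,n})^\dagger\alpha^L_{1,n}\big)^{-1}=W_{-1}-nI.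 \end{aligned}$$ Moreover, for every $n\ge1$, $$\begin{aligned} \text{(v)}\quad&\alpha^L_{1,n}=W_0^{-n+1}\,\alpha^L_{1,1}\,(W_{-1}-I)\cdots(W_{-1}-(n-1)I),\\ \text{(vi)}\quad&(\alpha^R_{2,n})^\dagger=(W_{-1}-nI)^{-1}\cdots(W_{-1}-2I)^{-1}(\alpha^R_{2,1})^\dagger\,W_0^{n-1}, \end{aligned}$$ and $$\text{(vii)}\quad(\alpha^R_{2,1})^\dagger\alpha^L_{1,1}=W_{-1}(W_{-1}-I)^{-1}.$$ (2) These formulas give the general solution of the system. For arbitrary sequences $(A_n)_{n\ge1}$, $(B_n)_{n\ge1}$ in $\mathbb C^{N\times N}$, read (i)–(vii) with $A_n$ in place of $\alpha^L_{1,n}$ and $B_n$ in place of $(\alpha^R_{2,n})^\dagger$. Then (i) and (iii) for all $n\ge2$ together with (ii) and (iv) for all $n\ge1$ (the invertibility of $I-B_nA_n$ being part of (iv)) hold if and only if (v) and (vi) hold for all $n\ge1$ and (vii) holds. -/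

import Mathlib

open Matrix Polynomial ComplexConjugate

noncomputable section

/-- The right logarithmic derivative `w'(z) w(z)⁻¹` of a matrix-valued function `w`
(the derivative is taken entrywise). -/
def rightLogDeriv {N : ℕ} (w : ℂ → Matrix (Fin N) (Fin N) ℂ) (z : ℂ) :
    Matrix (Fin N) (Fin N) ℂ :=
  (Matrix.of fun i j => deriv (fun u => w u i j) z) * (w z)⁻¹

/-- `w` is holomorphic on the punctured plane `ℂ \ {0}`, with invertible values there
(so that its inverse is holomorphic on `ℂ \ {0}` as well). -/
structure IsHolomorphicInvertibleWeight {N : ℕ} (w : ℂ → Matrix (Fin N) (Fin N) ℂ) : Prop where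
  differentiableOn : ∀ i j, DifferentiableOn ℂ (fun z => w z i j) {0}ᶜ
  isUnit : ∀ z : ℂ, z ≠ 0 → IsUnit (w z)

/-- The entrywise integral `∮ F(ζ) dm(ζ)` over the unit circle, where
`dm(ζ) = dζ / (2 π i ζ)` is the normalized Lebesgue measure. -/
def circleMatIntegral {N : ℕ} (F : ℂ → Matrix (Fin N) (Fin N) ℂ) : Matrix (Fin N) (Fin N) ℂ :=
  Matrix.of fun i j =>
    (2 * Real.pi * Complex.I)⁻¹ * circleIntegral (fun ζ => ζ⁻¹ * F ζ i j) 0 1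

/-- The moments `∮ ζ̄ᵏ w(ζ) dm(ζ)`, `k ∈ ℤ`, of the matrix of measures `w dm`. -/
def moment {N : ℕ} (w : ℂ → Matrix (Fin N) (Fin N) ℂ) (k : ℤ) : Matrix (Fin N) (Fin N) ℂ :=
  circleMatIntegral fun ζ => (conj ζ) ^ k • w ζ

/-- The truncated left block Toeplitz moment matrix, with blocks `moment (i - j)`. -/
def leftMomentMatrix {N : ℕ} (w : ℂ → Matrix (Fin N) (Fin N) ℂ) (n : ℕ) :
    Matrix (Fin n × Fin N) (Fin n × Fin N) ℂ :=
  Matrix.of fun p q => moment w ((p.1 : ℤ) - (q.1 : ℤ)) p.2 q.2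

/-- The truncated right block Toeplitz moment matrix, with blocks `moment (j - i)`. -/
def rightMomentMatrix {N : ℕ} (w : ℂ → Matrix (Fin N) (Fin N) ℂ) (n : ℕ) :
    Matrix (Fin n × Fin N) (Fin n × Fin N) ℂ :=
  Matrix.of fun p q => moment w ((q.1 : ℤ) - (p.1 : ℤ)) p.2 q.2

/-- Quasi-definiteness of the matrix of measures `w dm`. -/
def QuasiDefinite {N : ℕ} (w : ℂ → Matrix (Fin N) (Fin N) ℂ) : Prop :=
  ∀ n : ℕ, 1 ≤ n → (leftMomentMatrix w n).det ≠ 0 ∧ (rightMomentMatrix w n).det ≠ 0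

/-- The value `P(z) = ∑ₖ Pₖ zᵏ` of a polynomial with matrix coefficients at a complex number. -/
def matEval {N : ℕ} (P : (Matrix (Fin N) (Fin N) ℂ)[X]) (z : ℂ) : Matrix (Fin N) (Fin N) ℂ :=
  P.eval (Matrix.scalar (Fin N) z)

/-- `P` is monic of degree `n`: `P(z) = P₀ + ⋯ + Pₙ₋₁ zⁿ⁻¹ + I zⁿ`. -/
def IsMonicOfDegree {N : ℕ} (n : ℕ) (P : (Matrix (Fin N) (Fin N) ℂ)[X]) : Prop :=
  P.natDegree ≤ n ∧ P.coeff n = 1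

/-- `P` is the `n`-th left monic matrix Szegő polynomial of the first family for `w dm`. -/
def IsSzegoL1 {N : ℕ} (w : ℂ → Matrix (Fin N) (Fin N) ℂ) (n : ℕ)
    (P : (Matrix (Fin N) (Fin N) ℂ)[X]) : Prop :=
  IsMonicOfDegree n P ∧
    ∀ j < n, circleMatIntegral (fun ζ => (conj ζ) ^ j • (matEval P ζ * w ζ)) = 0

/-- `P` is the `n`-th right monic matrix Szegő polynomial of the second family for `w dm`. -/
def IsSzegoR2 {N : ℕ} (w : ℂ → Matrix (Fin N) (Fin N) ℂ) (n : ℕ)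
    (P : (Matrix (Fin N) (Fin N) ℂ)[X]) : Prop :=
  IsMonicOfDegree n P ∧
    ∀ j < n, circleMatIntegral (fun ζ => ζ ^ j • ((matEval P ζ)ᴴ * w ζ)) = 0

/-- The Verblunsky matrix of a Szegő polynomial: its value at the origin. -/
def verblunsky {N : ℕ} (P : (Matrix (Fin N) (Fin N) ℂ)[X]) : Matrix (Fin N) (Fin N) ℂ :=
  matEval P 0

/-- `A` is similar to a diagonal matrix. -/
def IsDiagonalizableMatrix {N : ℕ} (A : Matrix (Fin N) (Fin N) ℂ) : Prop :=
  ∃ (S : Matrix (Fin N) (Fin N) ℂ) (d : Fin N → ℂ), IsUnit S ∧ A = S * Matrix.diagonal d * S⁻¹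

/-- First equation of the system at site `n ≥ 1`:
`[aₙ bₙ₋₁, W₀] = aₙ (W₋₁ - n I) bₙ - aₙ₋₁ (W₋₁ - (n-1) I) bₙ₋₁`. -/
def SystemEq1 {N : ℕ} (Wm W0 : Matrix (Fin N) (Fin N) ℂ)
    (a b : ℕ → Matrix (Fin N) (Fin N) ℂ) (n : ℕ) : Prop :=
  ⁅a n * b (n - 1), W0⁆ =
    a n * (Wm - (n : ℂ) • 1) * b n - a (n - 1) * (Wm - ((n : ℂ) - 1) • 1) * b (n - 1)

/-- Second equation at site `n`: `W₀ aₙ₊₁ = aₙ (W₋₁ - n I)`. -/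
def SystemEq2 {N : ℕ} (Wm W0 : Matrix (Fin N) (Fin N) ℂ)
    (a : ℕ → Matrix (Fin N) (Fin N) ℂ) (n : ℕ) : Prop :=
  W0 * a (n + 1) = a n * (Wm - (n : ℂ) • 1)

/-- Third equation at site `n ≥ 1`: `bₙ₋₁ W₀ = (W₋₁ - n I) bₙ`. -/
def SystemEq3 {N : ℕ} (Wm W0 : Matrix (Fin N) (Fin N) ℂ)
    (b : ℕ → Matrix (Fin N) (Fin N) ℂ) (n : ℕ) : Prop :=
  b (n - 1) * W0 = (Wm - (n : ℂ) • 1) * b n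

/-- Fourth equation at site `n`: `I - bₙ aₙ` is invertible and
`-n (I - bₙ aₙ)⁻¹ = W₋₁ - n I`. -/
def SystemEq4 {N : ℕ} (Wm : Matrix (Fin N) (Fin N) ℂ)
    (a b : ℕ → Matrix (Fin N) (Fin N) ℂ) (n : ℕ) : Prop :=
  IsUnit (1 - b n * a n) ∧ (-(n : ℂ)) • (1 - b n * a n)⁻¹ = Wm - (n : ℂ) • 1

/-- The explicit products at every site `n ≥ 1`:
`aₙ = W₀^{-n+1} a₁ (W₋₁ - I) ⋯ (W₋₁ - (n-1) I)` and
`bₙ = (W₋₁ - n I)⁻¹ ⋯ (W₋₁ - 2 I)⁻¹ b₁ W₀^{n-1}`. -/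
def IsExplicitProduct {N : ℕ} (Wm W0 : Matrix (Fin N) (Fin N) ℂ)
    (a b : ℕ → Matrix (Fin N) (Fin N) ℂ) : Prop :=
  ∀ n : ℕ, 1 ≤ n →
    a n = W0⁻¹ ^ (n - 1) * a 1 *
        ((List.range (n - 1)).map fun k : ℕ => Wm - ((k : ℂ) + 1) • 1).prod ∧
    b n = ((List.range (n - 1)).map fun k : ℕ => (Wm - ((n : ℂ) - (k : ℂ)) • 1)⁻¹).prod *
        b 1 * W0 ^ (n - 1)

end

/-! Integrating the derivative of `ζ ^ (-k) * w` over the circle turns the differential equation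
into a two-term recursion for the moments c_k (`moment_recursion`). Write a_n, b_n for the
Verblunsky matrix of P = P^L_{1,n} and the adjoint of that of P^R_{2,n}. The recursion makes z P' +
P (W₋₁ + z W₀) - n P - W₀ P^L_{1,n+1} a polynomial of degree at most n orthogonal to 1, ..., z^n;
quasi-definiteness kills it, and its value at 0 is (ii). The same argument for the second family
gives b_n W₀ a_{n+1} = W₋₁.

The rest is algebra. With (ii) this identity reads b_n a_n (W₋₁ - n) = W₋₁, which is (iv), and (vii)
at n = 1. Negativity of the spectrum makes every W₋₁ - n with n ≥ 0 invertible; hence a_{n+1} is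
invertible and can be cancelled to give (iii). Equation (i) follows from (ii) and (iii), whose
iteration gives (v) and (vi). Conversely, (ii) and (iii) propagate (iv) from n = 1 to all n. -/

section SzegoVerblunsky

variable {N : ℕ}

/-! ### Uniqueness from quasi-definiteness -/

/-- A block matrix with nonzero determinant has trivial left kernel in the block sense. -/
lemma blockRow_eq_zero_of_det_ne_zero {n : ℕ}
    (f : Fin n → Fin n → Matrix (Fin N) (Fin N) ℂ)
    (hdet : (Matrix.of fun p q : Fin n × Fin N => f p.1 q.1 p.2 q.2).det ≠ 0)
    (x : Fin n → Matrix (Fin N) (Fin N) ℂ) (hx : ∀ j, ∑ i, x i * f i j = 0) (i : Fin n) :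
    x i = 0 := by
  ext r k
  have h := Matrix.eq_zero_of_vecMul_eq_zero (v := fun p : Fin n × Fin N => x p.1 r p.2) hdet
    (by
      ext q
      have h1 := congrFun (congrFun (hx q.1) r) q.2
      rw [Matrix.sum_apply] at h1
      simpa [Matrix.vecMul, dotProduct, Fintype.sum_prod_type, Matrix.mul_apply] using h1)
  exact congrFun h (i, k)

/-- Uniqueness for polynomials ∑ xᵢ zⁱ of degree below n: the hypothesis is orthogonality to 1, ...,
z^(n-1). `leftMoment_unique` plays this role for polynomials in z⁻¹. -/
lemma rightMoment_unique {w : ℂ → Matrix (Fin N) (Fin N) ℂ} (hq : QuasiDefinite w) {n : ℕ}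
    (hn : 1 ≤ n) (x : ℕ → Matrix (Fin N) (Fin N) ℂ)
    (hx : ∀ j < n, ∑ i ∈ Finset.range n, x i * moment w ((j : ℤ) - i) = 0) :
    ∀ i < n, x i = 0 := fun i hi =>
  blockRow_eq_zero_of_det_ne_zero (fun i j : Fin n => moment w ((j : ℤ) - (i : ℤ)))
    (hq n hn).2 (fun i => x i)
    (fun j => by rw [← hx j j.2, Finset.sum_range]) ⟨i, hi⟩

lemma leftMoment_unique {w : ℂ → Matrix (Fin N) (Fin N) ℂ} (hq : QuasiDefinite w) {n : ℕ}
    (hn : 1 ≤ n) (x : ℕ → Matrix (Fin N) (Fin N) ℂ)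
    (hx : ∀ j < n, ∑ i ∈ Finset.range n, x i * moment w ((i : ℤ) - j) = 0) :
    ∀ i < n, x i = 0 := fun i hi =>
  blockRow_eq_zero_of_det_ne_zero (fun i j : Fin n => moment w ((i : ℤ) - (j : ℤ)))
    (hq n hn).1 (fun i => x i)
    (fun j => by rw [← hx j j.2, Finset.sum_range]) ⟨i, hi⟩

/-! ### Circle integrals and moments -/

lemma conj_eq_inv_of_mem_sphere {ζ : ℂ} (h : ζ ∈ Metric.sphere (0 : ℂ) 1) : conj ζ = ζ⁻¹ := by
  have h1 : ‖ζ‖ = 1 := by simpa using h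
  rw [Complex.inv_def, Complex.normSq_eq_norm_sq, h1]
  simp

lemma ne_zero_of_mem_sphere_zero_one {ζ : ℂ} (h : ζ ∈ Metric.sphere (0 : ℂ) 1) : ζ ≠ 0 := by
  rintro rfl
  simp at h

lemma circleMatIntegral_congr {F G : ℂ → Matrix (Fin N) (Fin N) ℂ}
    (h : ∀ ζ ∈ Metric.sphere (0 : ℂ) 1, F ζ = G ζ) : circleMatIntegral F = circleMatIntegral G := by
  ext i j
  simp only [circleMatIntegral, Matrix.of_apply]
  congr 1
  exact circleIntegral.integral_congr zero_le_one fun ζ hζ => by simp only [h ζ hζ]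

lemma moment_eq (w : ℂ → Matrix (Fin N) (Fin N) ℂ) (k : ℤ) :
    moment w k = circleMatIntegral fun ζ => ζ ^ (-k) • w ζ :=
  circleMatIntegral_congr fun ζ hζ => by
    simp only [conj_eq_inv_of_mem_sphere hζ, _root_.inv_zpow']

lemma circleIntegrable_zpow_weight {w : ℂ → Matrix (Fin N) (Fin N) ℂ}
    (hw : IsHolomorphicInvertibleWeight w) (k : ℤ) (i j : Fin N) :
    CircleIntegrable (fun ζ => ζ⁻¹ * (ζ ^ k * w ζ i j)) 0 1 := by
  apply ContinuousOn.circleIntegrable zero_le_one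
  intro ζ hζ
  have h0 := ne_zero_of_mem_sphere_zero_one hζ
  have h1 : ContinuousAt (fun z => w z i j) ζ :=
    ((hw.differentiableOn i j).differentiableAt (isOpen_compl_singleton.mem_nhds h0)).continuousAt
  exact ((continuousAt_inv₀ h0).mul ((continuousAt_zpow₀ ζ k (Or.inl h0)).mul h1)).continuousWithinAt

/-- Integrating a matrix Laurent polynomial against `w dm` gives a combination of moments. -/
lemma circleMatIntegral_laurent {w : ℂ → Matrix (Fin N) (Fin N) ℂ}
    (hw : IsHolomorphicInvertibleWeight w) (s : Finset ℕ) (e : ℕ → ℤ)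
    (M : ℕ → Matrix (Fin N) (Fin N) ℂ) :
    circleMatIntegral (fun ζ => ∑ l ∈ s, ζ ^ (-e l) • (M l * w ζ)) =
      ∑ l ∈ s, M l * moment w (e l) := by
  ext i j
  rw [Matrix.sum_apply]
  simp only [Matrix.mul_apply, moment_eq, circleMatIntegral, Matrix.of_apply, Matrix.sum_apply,
    Matrix.smul_apply, smul_eq_mul, Finset.mul_sum]
  have hint : ∀ l ∈ s, ∀ k ∈ (Finset.univ : Finset (Fin N)),
      CircleIntegrable (fun ζ => M l i k * (ζ⁻¹ * (ζ ^ (-e l) * w ζ k j))) 0 1 := fun l _ k _ =>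
    (circleIntegrable_zpow_weight hw (-e l) k j).const_smul (a := M l i k)
  have hcongr : (fun ζ : ℂ => ∑ l ∈ s, ∑ k, ζ⁻¹ * (ζ ^ (-e l) * (M l i k * w ζ k j))) =
      fun ζ => ∑ l ∈ s, ∑ k, M l i k * (ζ⁻¹ * (ζ ^ (-e l) * w ζ k j)) := by
    funext ζ
    refine Finset.sum_congr rfl fun l _ => Finset.sum_congr rfl fun k _ => by ring
  rw [hcongr, circleIntegral.integral_fun_sum fun l hl => CircleIntegrable.fun_sum _ (hint l hl),
    Finset.mul_sum]
  refine Finset.sum_congr rfl fun l hl => ?_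
  rw [circleIntegral.integral_fun_sum (hint l hl), Finset.mul_sum]
  refine Finset.sum_congr rfl fun k _ => ?_
  rw [circleIntegral.integral_const_mul]
  ring

/-- The recursion for the moments that the equation `w' = (W₋₁ z⁻¹ + W₀) w` imposes. -/
lemma moment_recursion {Wm W0 : Matrix (Fin N) (Fin N) ℂ} {w : ℂ → Matrix (Fin N) (Fin N) ℂ}
    (hw : IsHolomorphicInvertibleWeight w)
    (hode : ∀ z : ℂ, z ≠ 0 → rightLogDeriv w z = z⁻¹ • Wm + W0) (k : ℤ) :
    W0 * moment w (k - 1) = -((Wm - (k : ℂ) • 1) * moment w k) := by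
  suffices h : (Wm - (k : ℂ) • 1) * moment w k + W0 * moment w (k - 1) = 0 from
    eq_neg_of_add_eq_zero_right h
  have hderiv : ∀ z : ℂ, z ≠ 0 → ∀ i j,
      deriv (fun u => w u i j) z = ((z⁻¹ • Wm + W0) * w z) i j := by
    intro z hz i j
    rw [← hode z hz, rightLogDeriv, Matrix.mul_assoc,
      Matrix.nonsing_inv_mul _ ((Matrix.isUnit_iff_isUnit_det _).1 (hw.isUnit z hz)),
      Matrix.mul_one, Matrix.of_apply]
  have hlin := circleMatIntegral_laurent hw (Finset.range 2) (fun l => k - l)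
    (fun l => if l = 0 then Wm - (k : ℂ) • 1 else W0)
  simp only [Finset.sum_range_succ, Finset.sum_range_zero, zero_add, if_true, one_ne_zero,
    if_false, Nat.cast_zero, Nat.cast_one, sub_zero] at hlin
  rw [← hlin]
  ext i j
  simp only [circleMatIntegral, Matrix.of_apply, Matrix.zero_apply]
  convert mul_zero _
  -- The integrand has the single-valued primitive ζ^(-k) w on the punctured plane.
  refine circleIntegral.integral_eq_zero_of_hasDerivWithinAt (f := fun ζ => ζ ^ (-k) * w ζ i j)
    zero_le_one fun ζ hζ => ?_
  have h0 := ne_zero_of_mem_sphere_zero_one hζ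
  have h1 : HasDerivAt (fun z => w z i j) (((ζ⁻¹ • Wm + W0) * w ζ) i j) ζ := by
    rw [← hderiv ζ h0]
    exact ((hw.differentiableOn i j).differentiableAt
      (isOpen_compl_singleton.mem_nhds h0)).hasDerivAt
  have h2 := ((hasDerivAt_zpow (-k) ζ (Or.inl h0)).mul h1).hasDerivWithinAt
    (s := Metric.sphere (0 : ℂ) 1)
  refine h2.congr_deriv ?_
  have e1 : ζ ^ (-k - 1) = ζ ^ (-k) * ζ⁻¹ := zpow_sub_one₀ h0 _
  have e2 : ζ ^ (-(k - 1)) = ζ ^ (-k) * ζ := by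
    rw [show -(k - 1) = -k + 1 by ring, zpow_add_one₀ h0]
  rw [e1, e2]
  simp only [Matrix.add_mul, Matrix.sub_mul, Matrix.smul_mul, Matrix.one_mul, Matrix.add_apply,
    Matrix.sub_apply, Matrix.smul_apply, smul_eq_mul, Int.cast_neg]
  field_simp
  ring

/-! ### Orthogonality as linear equations in the moments -/

lemma matEval_eq_sum {n : ℕ} {P : (Matrix (Fin N) (Fin N) ℂ)[X]} (hP : P.natDegree ≤ n) (z : ℂ) :
    matEval P z = ∑ i ∈ Finset.range (n + 1), z ^ i • P.coeff i := by
  rw [matEval, Polynomial.eval_eq_sum_range' (Nat.lt_succ_of_le hP)]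
  refine Finset.sum_congr rfl fun i _ => ?_
  rw [← map_pow, Matrix.scalar_apply, ← Matrix.smul_one_eq_diagonal, Matrix.mul_smul,
    Matrix.mul_one]

lemma verblunsky_eq_coeff_zero (P : (Matrix (Fin N) (Fin N) ℂ)[X]) :
    verblunsky P = P.coeff 0 := by
  rw [verblunsky, matEval, map_zero, ← Polynomial.coeff_zero_eq_eval_zero]

lemma IsSzegoL1.sum_moment_eq_zero {w : ℂ → Matrix (Fin N) (Fin N) ℂ}
    (hw : IsHolomorphicInvertibleWeight w) {n : ℕ} {P : (Matrix (Fin N) (Fin N) ℂ)[X]}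
    (hP : IsSzegoL1 w n P) {j : ℕ} (hj : j < n) :
    ∑ i ∈ Finset.range (n + 1), P.coeff i * moment w ((j : ℤ) - i) = 0 := by
  rw [← hP.2 j hj, ← circleMatIntegral_laurent hw _ (fun i : ℕ => (j : ℤ) - i)]
  refine circleMatIntegral_congr fun ζ hζ => ?_
  have h0 := ne_zero_of_mem_sphere_zero_one hζ
  rw [matEval_eq_sum hP.1.1, Finset.sum_mul, Finset.smul_sum, conj_eq_inv_of_mem_sphere hζ]
  refine Finset.sum_congr rfl fun i _ => ?_
  rw [Matrix.smul_mul, smul_smul, neg_sub, zpow_sub₀ h0, zpow_natCast, zpow_natCast, inv_pow,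
    div_eq_inv_mul]

lemma IsSzegoR2.sum_moment_eq_zero {w : ℂ → Matrix (Fin N) (Fin N) ℂ}
    (hw : IsHolomorphicInvertibleWeight w) {n : ℕ} {P : (Matrix (Fin N) (Fin N) ℂ)[X]}
    (hP : IsSzegoR2 w n P) {j : ℕ} (hj : j < n) :
    ∑ i ∈ Finset.range (n + 1), (P.coeff i)ᴴ * moment w ((i : ℤ) - j) = 0 := by
  rw [← hP.2 j hj, ← circleMatIntegral_laurent hw _ (fun i : ℕ => (i : ℤ) - j)]
  refine circleMatIntegral_congr fun ζ hζ => ?_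
  have h0 := ne_zero_of_mem_sphere_zero_one hζ
  rw [matEval_eq_sum hP.1.1, Matrix.conjTranspose_sum, Finset.sum_mul, Finset.smul_sum]
  refine Finset.sum_congr rfl fun i _ => ?_
  rw [Matrix.conjTranspose_smul, star_pow, ← starRingEnd_apply, conj_eq_inv_of_mem_sphere hζ,
    Matrix.smul_mul, smul_smul, neg_sub, zpow_sub₀ h0, zpow_natCast, zpow_natCast, inv_pow,
    div_eq_mul_inv]

/-! ### Structure relations for the two families -/

/-- The structure relation `z P' + P (W₋₁ + z W₀) = W₀ Pₙ₊₁ + n Pₙ`, evaluated at the origin. -/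
lemma systemEq2_of_weight {Wm W0 : Matrix (Fin N) (Fin N) ℂ}
    {w : ℂ → Matrix (Fin N) (Fin N) ℂ} (hw : IsHolomorphicInvertibleWeight w)
    (hode : ∀ z : ℂ, z ≠ 0 → rightLogDeriv w z = z⁻¹ • Wm + W0) (hq : QuasiDefinite w)
    {n : ℕ} {P Q : (Matrix (Fin N) (Fin N) ℂ)[X]} (hP : IsSzegoL1 w n P)
    (hQ : IsSzegoL1 w (n + 1) Q) :
    W0 * verblunsky Q = verblunsky P * (Wm - (n : ℂ) • 1) := by
  set c := moment w with hc
  have hrec := moment_recursion hw hode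
  -- The coefficients of z P' + P (W₋₁ + z W₀) - n P - W₀ Q. Both P and Q are monic, so the one at
  -- z^(n+1) cancels.
  let x : ℕ → Matrix (Fin N) (Fin N) ℂ := fun i =>
    P.coeff i * (Wm + ((i : ℂ) - n) • 1) + (if i = 0 then 0 else P.coeff (i - 1) * W0)
      - W0 * Q.coeff i
  have hPtop : P.coeff (n + 1) = 0 :=
    Polynomial.coeff_eq_zero_of_natDegree_lt (Nat.lt_succ_of_le hP.1.1)
  have hxtop : x (n + 1) = 0 := by
    simp [x, hPtop, hP.1.2, hQ.1.2]
  have hx := rightMoment_unique hq (Nat.succ_pos n) x (fun j hj => ?_) 0 (Nat.succ_pos n)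
  · simp only [x, if_true, Nat.cast_zero, zero_sub, add_zero] at hx
    rw [verblunsky_eq_coeff_zero, verblunsky_eq_coeff_zero, ← sub_eq_zero.1 hx, neg_smul,
      sub_eq_add_neg]
  · have hext : ∑ i ∈ Finset.range (n + 1), x i * c ((j : ℤ) - i) =
        ∑ i ∈ Finset.range (n + 2), x i * c ((j : ℤ) - i) := by
      rw [Finset.sum_range_succ _ (n + 1), hxtop, zero_mul, add_zero]
    have hshift : ∑ i ∈ Finset.range (n + 2),
        (if i = 0 then 0 else P.coeff (i - 1) * W0) * c ((j : ℤ) - i) =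
        ∑ i ∈ Finset.range (n + 1),
          -(P.coeff i * ((Wm - ((j : ℂ) - i) • 1) * c ((j : ℤ) - i))) := by
      rw [Finset.sum_range_succ']
      simp only [if_true, zero_mul, add_zero, Nat.succ_ne_zero, if_false, Nat.add_sub_cancel]
      refine Finset.sum_congr rfl fun i _ => ?_
      have h := hrec ((j : ℤ) - i)
      push_cast at h ⊢
      rw [← sub_sub, Matrix.mul_assoc, h, Matrix.mul_neg]
    have hmain : ∑ i ∈ Finset.range (n + 2),
        P.coeff i * (Wm + ((i : ℂ) - n) • 1) * c ((j : ℤ) - i) =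
        ∑ i ∈ Finset.range (n + 1), P.coeff i * ((Wm + ((i : ℂ) - n) • 1) * c ((j : ℤ) - i)) := by
      rw [Finset.sum_range_succ, hPtop]
      simp only [zero_mul, add_zero, Matrix.mul_assoc]
    have hQ0 : ∑ i ∈ Finset.range (n + 2), W0 * Q.coeff i * c ((j : ℤ) - i) = 0 := by
      simp only [Matrix.mul_assoc, ← Finset.mul_sum]
      rw [hQ.sum_moment_eq_zero hw hj, mul_zero]
    rw [hext]
    simp only [x, Matrix.sub_mul, Matrix.add_mul (_ * _), Finset.sum_sub_distrib,
      Finset.sum_add_distrib]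
    rw [hQ0, hshift, hmain, sub_zero, ← Finset.sum_add_distrib]
    -- The i-dependence cancels, leaving the scalar j - n: orthogonality of P covers j < n, and the
    -- factor vanishes at j = n.
    have : ∀ i ∈ Finset.range (n + 1),
        P.coeff i * ((Wm + ((i : ℂ) - n) • 1) * c ((j : ℤ) - i)) +
          -(P.coeff i * ((Wm - ((j : ℂ) - i) • 1) * c ((j : ℤ) - i))) =
        ((j : ℂ) - n) • (P.coeff i * c ((j : ℤ) - i)) := by
      intro i _
      rw [← sub_eq_add_neg, ← Matrix.mul_sub, ← Matrix.sub_mul, ← Matrix.mul_smul]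
      congr 1
      rw [show Wm + ((i : ℂ) - n) • (1 : Matrix (Fin N) (Fin N) ℂ) - (Wm - ((j : ℂ) - i) • 1) =
        ((j : ℂ) - n) • 1 by module, Matrix.smul_mul, Matrix.one_mul]
    rw [Finset.sum_congr rfl this, ← Finset.smul_sum]
    rcases (Nat.lt_succ_iff.1 hj).lt_or_eq with h | h
    · rw [hP.sum_moment_eq_zero hw h, smul_zero]
    · rw [h, sub_self, zero_smul]

/-- The structure relation of the second family, compared in the top coefficient. -/
lemma conj_verblunsky_mul_of_weight {Wm W0 : Matrix (Fin N) (Fin N) ℂ}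
    {w : ℂ → Matrix (Fin N) (Fin N) ℂ} (hw : IsHolomorphicInvertibleWeight w)
    (hode : ∀ z : ℂ, z ≠ 0 → rightLogDeriv w z = z⁻¹ • Wm + W0) (hq : QuasiDefinite w)
    {n : ℕ} {R Q : (Matrix (Fin N) (Fin N) ℂ)[X]} (hR : IsSzegoR2 w n R)
    (hQ : IsSzegoL1 w (n + 1) Q) :
    (verblunsky R)ᴴ * W0 * verblunsky Q = Wm := by
  set c := moment w with hc
  have hrec := moment_recursion hw hode
  rw [verblunsky_eq_coeff_zero, verblunsky_eq_coeff_zero]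
  set s : ℕ → Matrix (Fin N) (Fin N) ℂ := fun i => (R.coeff i)ᴴ with hs
  change s 0 * W0 * Q.coeff 0 = Wm
  have hs_zero : s (n + 1) = 0 := by
    simp [hs, Polynomial.coeff_eq_zero_of_natDegree_lt (Nat.lt_succ_of_le hR.1.1)]
  have hsn : s n = 1 := by simp [hs, hR.1.2]
  -- Coefficients of z^(-i) when R† (a polynomial in z⁻¹) replaces P. Multiplying by z W₀ leaves a
  -- stray term s₀ W₀ z; subtracting s₀ W₀ z^(-n) Q, with Q monic of degree n + 1, removes it.
  let t : ℕ → Matrix (Fin N) (Fin N) ℂ := fun i =>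
    s i * (Wm + ((n : ℂ) - i) • 1) + s (i + 1) * W0 - s 0 * W0 * Q.coeff (n - i)
  have ht := leftMoment_unique hq (Nat.succ_pos n) t (fun j hj => ?_) n (Nat.lt_succ_self n)
  · simp only [t, hs_zero, hsn, sub_self, zero_smul, add_zero, one_mul, zero_mul,
      Nat.sub_self] at ht
    exact (sub_eq_zero.1 ht).symm
  · have hshift : ∑ i ∈ Finset.range (n + 1), s (i + 1) * W0 * c ((i : ℤ) - j) =
        ∑ i ∈ Finset.range (n + 1), -(s i * ((Wm - ((i : ℂ) - j) • 1) * c ((i : ℤ) - j)))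
          - s 0 * W0 * c (-1 - (j : ℤ)) := by
      have h1 := Finset.sum_range_succ' (fun i : ℕ => s i * W0 * c ((i : ℤ) - j - 1)) (n + 1)
      rw [Finset.sum_range_succ, hs_zero, zero_mul, zero_mul, add_zero] at h1
      have h2 : ∀ i ∈ Finset.range (n + 1), s i * W0 * c ((i : ℤ) - j - 1) =
          -(s i * ((Wm - ((i : ℂ) - j) • 1) * c ((i : ℤ) - j))) := by
        intro i _
        have h := hrec ((i : ℤ) - j)
        push_cast at h
        rw [Matrix.mul_assoc, h, Matrix.mul_neg]
      rw [Finset.sum_congr rfl h2] at h1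
      rw [h1, show ((0 : ℕ) : ℤ) - j - 1 = -1 - j by push_cast; ring, add_sub_cancel_right]
      refine Finset.sum_congr rfl fun i _ => ?_
      rw [show ((i + 1 : ℕ) : ℤ) - j - 1 = i - j by push_cast; ring]
    have hQ0 : ∑ i ∈ Finset.range (n + 1), s 0 * W0 * Q.coeff (n - i) * c ((i : ℤ) - j) =
        -(s 0 * W0 * c (-1 - (j : ℤ))) := by
      -- The factor z^(-n) turns condition j into the condition n - j on Q.
      have h1 := hQ.sum_moment_eq_zero hw (j := n - j) (by omega)
      rw [Finset.sum_range_succ, hQ.1.2, one_mul, ← Finset.sum_range_reflect,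
        Nat.cast_sub (Nat.lt_succ_iff.1 hj)] at h1
      simp only [Matrix.mul_assoc, ← Finset.mul_sum]
      rw [← Matrix.mul_neg, ← Matrix.mul_neg]
      congr 2
      rw [show (-1 - (j : ℤ)) = (n : ℤ) - j - (n + 1 : ℕ) by push_cast; ring,
        ← eq_neg_of_add_eq_zero_left h1]
      refine Finset.sum_congr rfl fun i hi => ?_
      have hi' : i ≤ n := Nat.lt_succ_iff.1 (Finset.mem_range.1 hi)
      rw [show n + 1 - 1 - i = n - i by omega, Nat.cast_sub hi',
        show (n : ℤ) - j - (n - i) = i - j by ring]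
    simp only [t, Matrix.sub_mul, Matrix.add_mul (_ * _), Finset.sum_sub_distrib,
      Finset.sum_add_distrib]
    rw [hQ0, hshift, sub_neg_eq_add, add_assoc, sub_add_cancel, ← Finset.sum_add_distrib]
    have : ∀ i ∈ Finset.range (n + 1),
        s i * (Wm + ((n : ℂ) - i) • 1) * c ((i : ℤ) - j) +
          -(s i * ((Wm - ((i : ℂ) - j) • 1) * c ((i : ℤ) - j))) =
        ((n : ℂ) - j) • (s i * c ((i : ℤ) - j)) := by
      intro i _
      rw [Matrix.mul_assoc, ← sub_eq_add_neg, ← Matrix.mul_sub, ← Matrix.sub_mul, ← Matrix.mul_smul]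
      congr 1
      rw [show Wm + ((n : ℂ) - i) • (1 : Matrix (Fin N) (Fin N) ℂ) - (Wm - ((i : ℂ) - j) • 1) =
        ((n : ℂ) - j) • 1 by module, Matrix.smul_mul, Matrix.one_mul]
    rw [Finset.sum_congr rfl this, ← Finset.smul_sum]
    rcases (Nat.lt_succ_iff.1 hj).lt_or_eq with h | h
    · rw [hR.sum_moment_eq_zero hw h, smul_zero]
    · rw [h, sub_self, zero_smul]

/-! ### Algebra of the discrete system -/

lemma isUnit_sub_natCast_smul_one {Wm : Matrix (Fin N) (Fin N) ℂ}
    (heig : ∀ x ∈ spectrum ℂ Wm, ∃ k : ℤ, k < 0 ∧ x = (k : ℂ)) (n : ℕ) :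
    IsUnit (Wm - (n : ℂ) • 1) := by
  by_contra h
  have hn : (n : ℂ) ∈ spectrum ℂ Wm := by
    rw [spectrum.mem_iff, Algebra.algebraMap_eq_smul_one, ← neg_sub, IsUnit.neg_iff]
    exact h
  obtain ⟨k, hk, hkn⟩ := heig _ hn
  have : (n : ℤ) = k := by exact_mod_cast hkn
  omega

/-- The fourth equation amounts to `bₙ aₙ (W₋₁ - n I) = W₋₁`. -/
lemma systemEq4_iff {Wm : Matrix (Fin N) (Fin N) ℂ} (a b : ℕ → Matrix (Fin N) (Fin N) ℂ) {n : ℕ}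
    (hn : 1 ≤ n) : SystemEq4 Wm a b n ↔ b n * a n * (Wm - (n : ℂ) • 1) = Wm := by
  have hn0 : -(n : ℂ) ≠ 0 := neg_ne_zero.2 (Nat.cast_ne_zero.2 (by omega))
  set U := Wm - (n : ℂ) • (1 : Matrix (Fin N) (Fin N) ℂ) with hU
  have hWm : Wm = U + (n : ℂ) • 1 := by rw [hU, sub_add_cancel]
  constructor
  · rintro ⟨h1, h2⟩
    have h3 : (1 - b n * a n) * U = (-(n : ℂ)) • 1 := by
      rw [hU, ← h2, Matrix.mul_smul, Matrix.mul_nonsing_inv _ ((Matrix.isUnit_iff_isUnit_det _).1 h1)]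
    rw [Matrix.sub_mul, Matrix.one_mul, neg_smul] at h3
    rw [hWm, ← sub_eq_iff_eq_add', ← neg_sub, h3, neg_neg]
  · intro h
    have h3 : (1 - b n * a n) * ((-(n : ℂ))⁻¹ • U) = 1 := by
      rw [Matrix.mul_smul, Matrix.sub_mul, Matrix.one_mul, h, hWm, sub_add_cancel_left,
        ← neg_smul, smul_smul, inv_mul_cancel₀ hn0, one_smul]
    refine ⟨(Matrix.isUnit_iff_isUnit_det _).2 (Matrix.isUnit_det_of_right_inverse h3), ?_⟩
    rw [Matrix.inv_eq_right_inv h3, smul_smul, mul_inv_cancel₀ hn0, one_smul]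

/-- By (iii), aₙ (W₋₁ - n) bₙ = aₙ bₙ₋₁ W₀; by (ii) at n - 1, the subtracted term is W₀ aₙ bₙ₋₁. -/
lemma systemEq1_of_systemEq2_systemEq3 {Wm W0 : Matrix (Fin N) (Fin N) ℂ}
    {a b : ℕ → Matrix (Fin N) (Fin N) ℂ} {n : ℕ} (hn : 1 ≤ n)
    (h2 : SystemEq2 Wm W0 a (n - 1)) (h3 : SystemEq3 Wm W0 b n) : SystemEq1 Wm W0 a b n := by
  obtain ⟨m, rfl⟩ := Nat.exists_eq_add_of_le' hn
  simp only [SystemEq1, SystemEq2, SystemEq3, Nat.add_sub_cancel] at *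
  rw [Ring.lie_def, Matrix.mul_assoc (a (m + 1)) (Wm - _), ← h3, ← Matrix.mul_assoc W0, h2]
  push_cast
  rw [add_sub_cancel_right, Matrix.mul_assoc (a (m + 1))]

lemma isExplicitProduct_of_system {Wm W0 : Matrix (Fin N) (Fin N) ℂ} (hW0 : IsUnit W0)
    (hu : ∀ n : ℕ, IsUnit (Wm - (n : ℂ) • 1)) {a b : ℕ → Matrix (Fin N) (Fin N) ℂ}
    (h2 : ∀ n : ℕ, 1 ≤ n → SystemEq2 Wm W0 a n) (h3 : ∀ n : ℕ, 2 ≤ n → SystemEq3 Wm W0 b n) :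
    IsExplicitProduct Wm W0 a b := by
  have hdet0 := (Matrix.isUnit_iff_isUnit_det _).1 hW0
  intro n hn
  induction n, hn using Nat.le_induction with
  | base => simp
  | succ n hn ih =>
    obtain ⟨m, rfl⟩ := Nat.exists_eq_add_of_le' hn
    obtain ⟨iha, ihb⟩ := ih
    have ha := h2 (m + 1) hn
    have hb := h3 (m + 2) (by omega)
    simp only [SystemEq2, SystemEq3, Nat.add_sub_cancel, show m + 2 - 1 = m + 1 by omega]
      at ha hb iha ihb ⊢
    constructor
    · have ha' : a (m + 1 + 1) = W0⁻¹ * (a (m + 1) * (Wm - ((m + 1 : ℕ) : ℂ) • 1)) := by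
        rw [← ha, Matrix.nonsing_inv_mul_cancel_left _ _ hdet0]
      rw [ha', iha, List.range_succ, List.map_append, List.prod_append, pow_succ']
      simp [Matrix.mul_assoc]
    · have hb' : b (m + 1 + 1) = (Wm - ((m + 2 : ℕ) : ℂ) • 1)⁻¹ * (b (m + 1) * W0) := by
        rw [hb, Matrix.nonsing_inv_mul_cancel_left _ _
          ((Matrix.isUnit_iff_isUnit_det _).1 (hu (m + 2)))]
      -- The factors of bₙ descend from n, so the new one enters at the head and the old ones shift
      -- index; for aₙ it is appended at the end.
      rw [hb', ihb, List.range_succ_eq_map, List.map_cons, List.prod_cons, List.map_map, pow_succ]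
      simp only [Matrix.mul_assoc]
      congr 2
      · push_cast; congr 2; ring
      · congr 2
        funext k
        simp only [Function.comp_apply]
        push_cast
        congr 3
        ring

lemma systemEq2_of_isExplicitProduct {Wm W0 : Matrix (Fin N) (Fin N) ℂ} (hW0 : IsUnit W0)
    {a b : ℕ → Matrix (Fin N) (Fin N) ℂ} (h : IsExplicitProduct Wm W0 a b) {n : ℕ} (hn : 1 ≤ n) :
    SystemEq2 Wm W0 a n := by
  obtain ⟨m, rfl⟩ := Nat.exists_eq_add_of_le' hn
  have h0 := (h (m + 1) hn).1
  have h1 := (h (m + 1 + 1) (by omega)).1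
  simp only [Nat.add_sub_cancel] at h0 h1
  rw [SystemEq2, h1, h0, List.range_succ, List.map_append, List.prod_append, pow_succ']
  simp only [Matrix.mul_assoc]
  rw [Matrix.mul_nonsing_inv_cancel_left _ _ ((Matrix.isUnit_iff_isUnit_det _).1 hW0)]
  simp

lemma systemEq3_of_isExplicitProduct {Wm W0 : Matrix (Fin N) (Fin N) ℂ}
    (hu : ∀ n : ℕ, IsUnit (Wm - (n : ℂ) • 1)) {a b : ℕ → Matrix (Fin N) (Fin N) ℂ}
    (h : IsExplicitProduct Wm W0 a b) {n : ℕ} (hn : 2 ≤ n) : SystemEq3 Wm W0 b n := by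
  obtain ⟨m, rfl⟩ := Nat.exists_eq_add_of_le' hn
  have h0 := (h (m + 1) (by omega)).2
  have h1 := (h (m + 2) (by omega)).2
  simp only [Nat.add_sub_cancel, show m + 2 - 1 = m + 1 by omega] at h0 h1
  rw [SystemEq3, show m + 2 - 1 = m + 1 by omega, h1, h0, List.range_succ_eq_map, List.map_cons,
    List.prod_cons, List.map_map, pow_succ, Nat.cast_zero, sub_zero]
  simp only [Matrix.mul_assoc]
  rw [Matrix.mul_nonsing_inv_cancel_left _ _ ((Matrix.isUnit_iff_isUnit_det _).1 (hu (m + 2)))]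
  congr 2
  refine List.map_congr_left fun k _ => ?_
  simp only [Function.comp_apply]
  push_cast
  congr 3
  ring

lemma initial_condition_iff {Wm : Matrix (Fin N) (Fin N) ℂ}
    (hu : ∀ n : ℕ, IsUnit (Wm - (n : ℂ) • 1)) (X : Matrix (Fin N) (Fin N) ℂ) :
    X = Wm * (Wm - 1)⁻¹ ↔ X * (Wm - ((1 : ℕ) : ℂ) • 1) = Wm := by
  have hu1 := (Matrix.isUnit_iff_isUnit_det _).1 (hu 1)
  rw [Nat.cast_one, one_smul] at *
  constructor
  · rintro rfl
    rw [Matrix.nonsing_inv_mul_cancel_right _ _ hu1]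
  · intro h
    conv_rhs => enter [1]; rw [← h]
    rw [Matrix.mul_nonsing_inv_cancel_right _ _ hu1]

/-- The second and third equations propagate `bₙ aₙ (W₋₁ - n I) = W₋₁`. -/
lemma mul_mul_eq_of_isExplicitProduct {Wm W0 : Matrix (Fin N) (Fin N) ℂ} (hW0 : IsUnit W0)
    (hu : ∀ n : ℕ, IsUnit (Wm - (n : ℂ) • 1)) {a b : ℕ → Matrix (Fin N) (Fin N) ℂ}
    (h : IsExplicitProduct Wm W0 a b) (h1 : b 1 * a 1 * (Wm - ((1 : ℕ) : ℂ) • 1) = Wm) :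
    ∀ n : ℕ, 1 ≤ n → b n * a n * (Wm - (n : ℂ) • 1) = Wm := by
  intro n hn
  induction n, hn using Nat.le_induction with
  | base => exact h1
  | succ n hn ih =>
    have h2 : W0 * a (n + 1) = a n * (Wm - (n : ℂ) • 1) :=
      systemEq2_of_isExplicitProduct hW0 h hn
    have h3 : b n * W0 = (Wm - ((n + 1 : ℕ) : ℂ) • 1) * b (n + 1) :=
      systemEq3_of_isExplicitProduct hu h (n := n + 1) (by omega)
    set U := Wm - ((n + 1 : ℕ) : ℂ) • (1 : Matrix (Fin N) (Fin N) ℂ) with hU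
    have hUW : U * Wm = Wm * U := by
      rw [hU, Matrix.sub_mul, Matrix.mul_sub]
      simp
    -- Multiplied by U on the left, the claim becomes bₙ W₀ aₙ₊₁ U = W₋₁ U, since U commutes with
    -- W₋₁.
    refine (hu (n + 1)).mul_left_cancel ?_
    rw [← hU, hUW, ← Matrix.mul_assoc, ← Matrix.mul_assoc, ← h3, Matrix.mul_assoc (b n), h2,
      ← Matrix.mul_assoc, ih]

end SzegoVerblunsky

theorem mainTheorem8 {N : ℕ} (Wm W0 : Matrix (Fin N) (Fin N) ℂ)
    (hdiag : IsDiagonalizableMatrix Wm)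
    (heig : ∀ x ∈ spectrum ℂ Wm, ∃ k : ℤ, k < 0 ∧ x = (k : ℂ))
    (hW0 : IsUnit W0) :
    -- the Verblunsky matrices of every such weight
    (∀ w : ℂ → Matrix (Fin N) (Fin N) ℂ,
      IsHolomorphicInvertibleWeight w →
      (∀ z : ℂ, z ≠ 0 → rightLogDeriv w z = z⁻¹ • Wm + W0) →
      QuasiDefinite w →
      ∀ PL1 PR2 : ℕ → (Matrix (Fin N) (Fin N) ℂ)[X],
        (∀ n, IsSzegoL1 w n (PL1 n)) → (∀ n, IsSzegoR2 w n (PR2 n)) →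
        ∀ a b : ℕ → Matrix (Fin N) (Fin N) ℂ,
          (∀ n, a n = verblunsky (PL1 n)) → (∀ n, b n = (verblunsky (PR2 n))ᴴ) →
          (∀ n : ℕ, 1 ≤ n →
            SystemEq1 Wm W0 a b n ∧ SystemEq2 Wm W0 a n ∧
            SystemEq3 Wm W0 b n ∧ SystemEq4 Wm a b n) ∧
          IsExplicitProduct Wm W0 a b ∧
          b 1 * a 1 = Wm * (Wm - 1)⁻¹) ∧
    -- the general solution of the system, for arbitrary sequences indexed by `n ≥ 1`
    (∀ a b : ℕ → Matrix (Fin N) (Fin N) ℂ,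
      ((∀ n : ℕ, 2 ≤ n → SystemEq1 Wm W0 a b n) ∧
        (∀ n : ℕ, 1 ≤ n → SystemEq2 Wm W0 a n) ∧
        (∀ n : ℕ, 2 ≤ n → SystemEq3 Wm W0 b n) ∧
        (∀ n : ℕ, 1 ≤ n → SystemEq4 Wm a b n)) ↔
      (IsExplicitProduct Wm W0 a b ∧ b 1 * a 1 = Wm * (Wm - 1)⁻¹)) := by
  have hu := isUnit_sub_natCast_smul_one heig
  have hWm : IsUnit Wm := by simpa using hu 0
  refine ⟨?_, ?_⟩
  · intro w hw hode hq PL1 PR2 hL hR a b ha hb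
    have h2 : ∀ n, SystemEq2 Wm W0 a n := fun n => by
      rw [SystemEq2, ha, ha]
      exact systemEq2_of_weight hw hode hq (hL n) (hL (n + 1))
    have hba : ∀ n, b n * W0 * a (n + 1) = Wm := fun n => by
      rw [ha, hb]
      exact conj_verblunsky_mul_of_weight hw hode hq (hR n) (hL (n + 1))
    have h4 : ∀ n : ℕ, b n * a n * (Wm - (n : ℂ) • 1) = Wm := fun n => by
      rw [Matrix.mul_assoc, ← h2 n, ← Matrix.mul_assoc, hba]
    have h3 : ∀ n : ℕ, SystemEq3 Wm W0 b (n + 1) := fun n => by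
      have hau : IsUnit (a (n + 1)) := by
        have h : IsUnit (b n * W0 * a (n + 1)).det := by
          rw [hba]
          exact (Matrix.isUnit_iff_isUnit_det _).1 hWm
        rw [Matrix.det_mul] at h
        exact (Matrix.isUnit_iff_isUnit_det _).2 (isUnit_of_mul_isUnit_right h)
      rw [SystemEq3, Nat.add_sub_cancel]
      -- After multiplying by aₙ₊₁ (W₋₁ - (n+1)), both sides are products of W₋₁ and W₋₁ - (n+1),
      -- which commute.
      refine hau.mul_right_cancel ((hu (n + 1)).mul_right_cancel ?_)
      rw [hba, Matrix.mul_assoc, Matrix.mul_assoc, ← Matrix.mul_assoc (b (n + 1)), h4,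
        Matrix.sub_mul, Matrix.mul_sub]
      simp
    have h3' : ∀ n : ℕ, 1 ≤ n → SystemEq3 Wm W0 b n := fun n hn => by
      obtain ⟨m, rfl⟩ := Nat.exists_eq_add_of_le' hn
      exact h3 m
    exact ⟨fun n hn => ⟨systemEq1_of_systemEq2_systemEq3 hn (h2 _) (h3' n hn), h2 n, h3' n hn,
        (systemEq4_iff a b hn).2 (h4 n)⟩,
      isExplicitProduct_of_system hW0 hu (fun n _ => h2 n) fun n hn => h3' n (by omega),
      (initial_condition_iff hu _).2 (h4 1)⟩
  · intro a b
    constructor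
    · rintro ⟨-, h2, h3, h4⟩
      exact ⟨isExplicitProduct_of_system hW0 hu h2 h3,
        (initial_condition_iff hu _).2 ((systemEq4_iff a b le_rfl).1 (h4 1 le_rfl))⟩
    · rintro ⟨h, h1⟩
      have h2 : ∀ n : ℕ, 1 ≤ n → SystemEq2 Wm W0 a n := fun n hn =>
        systemEq2_of_isExplicitProduct hW0 h hn
      have h3 : ∀ n : ℕ, 2 ≤ n → SystemEq3 Wm W0 b n := fun n hn =>
        systemEq3_of_isExplicitProduct hu h hn
      exact ⟨fun n hn =>
          systemEq1_of_systemEq2_systemEq3 (by omega) (h2 _ (by omega)) (h3 n hn),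
        h2, h3, fun n hn => (systemEq4_iff a b hn).2
          (mul_mul_eq_of_isExplicitProduct hW0 hu h ((initial_condition_iff hu _).1 h1) n hn)⟩
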